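/- Let $p\ge 1$ be a fixed integer. For $n\ge 1$, a $p$-watermelon of length $2n$ (without wall) is a family of $p$ lattice paths in $\mathbb Z^2$ with steps $(1,1)$ and $(1,-1)$, where for $0\le i<p$ the $i$-th path starts at $(0,2i)$ and ends at $(2n,2i)$, such that no two of the paths share a lattice point. The height of a watermelon is the maximum ordinate reached by its top most path (the one with index $p-1$). Let $H_{n,p}$ be the height of a watermelon chosen uniformly at random from the finite set of all $p$-watermelons of length $2n$. For $k\ge 0$ let $$H_k(z)=k!\sum_{k/2\le m\le k}\frac{(-1)^{k-m}}{(k-m)!}\,\frac{(2z)^{2m-k}}{(2m-k)!}$$ be the $k$-th (physicists') Hermite polynomial. Then for each fixed $t\in(0,\infty)$, $$\mathbb P\left\{\frac{H_{n,p}+1}{\sqrt n}\le t\right\}=\frac{2^{-\binom p2}}{\prod_{j=0}^{p-1}j!}\,\det_{0\le i,j<p}\left((-1)^iH_{i+j}(0)-H_{i+j}(t)\,e^{-t^2}\right)+O\left(n^{-1/2}e^{-t^2}\right)$$ as $n\to\infty$, where the constant implied by $O$ may depend on $p$ and $t$. -/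

import Mathlib

open Asymptotics Filter
open scoped Nat

/-- A `p`-watermelon of length `2n` (without wall): `p` lattice paths with steps `(1,1)` and
`(1,-1)`, the `i`-th path (`0 ≤ i < p`) running from `(0,2i)` to `(2n,2i)`, no two of which ever
share a lattice point.  `path i k` is the ordinate of the `i`-th path at abscissa `k`. -/
@[ext]
structure Watermelon (p n : ℕ) where
  path : Fin p → Fin (2 * n + 1) → ℤ
  start_eq : ∀ i, path i 0 = 2 * (i : ℤ)
  end_eq : ∀ i, path i (Fin.last (2 * n)) = 2 * (i : ℤ)
  step : ∀ i (k : Fin (2 * n)),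
    path i k.succ = path i k.castSucc + 1 ∨ path i k.succ = path i k.castSucc - 1
  nonintersecting : ∀ i j, i ≠ j → ∀ k, path i k ≠ path j k

namespace Watermelon

variable {p n : ℕ}

/-- There are only finitely many watermelons: each is determined by its up-steps. -/
instance : Finite (Watermelon p n) := by
  classical
  refine Finite.of_injective
    (fun (w : Watermelon p n) (i : Fin p) (k : Fin (2 * n)) =>
      decide (w.path i k.succ = w.path i k.castSucc + 1)) ?_
  intro w v h
  ext i k
  induction k using Fin.induction with
  | zero => rw [w.start_eq, v.start_eq]
  | succ k ih =>
    have hk := congrFun (congrFun h i) k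
    simp only [decide_eq_decide] at hk
    rcases w.step i k with h1 | h1 <;> rcases v.step i k with h2 | h2 <;> omega

/-- The zigzag watermelon shows that watermelons exist. -/
instance : Nonempty (Watermelon p n) :=
  ⟨{ path := fun i k => 2 * (i : ℤ) + ((k : ℕ) % 2 : ℕ)
     start_eq := by intro i; simp
     end_eq := by intro i; simp
     step := by
       intro i k
       simp only [Fin.val_succ, Fin.val_castSucc]
       omega
     nonintersecting := by
       intro i j hij k h
       apply hij
       ext
       omega }⟩

instance : MeasurableSpace (Watermelon p n) := ⊤

instance : DiscreteMeasurableSpace (Watermelon p n) := ⟨fun _ => trivial⟩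

/-- The height of a watermelon: the maximum ordinate reached by its top most path, which is the
path with index `p - 1`. -/
def height (hp : 0 < p) (w : Watermelon p n) : ℤ :=
  Finset.univ.sup' Finset.univ_nonempty
    (fun k : Fin (2 * n + 1) => w.path ⟨p - 1, Nat.sub_lt hp Nat.one_pos⟩ k)

/-- The uniform probability measure on the set of `p`-watermelons of length `2n`. -/
noncomputable def uniform (p n : ℕ) : MeasureTheory.Measure (Watermelon p n) :=
  ProbabilityTheory.uniformOn Set.univ

instance : MeasureTheory.IsProbabilityMeasure (uniform p n) :=
  ProbabilityTheory.isProbabilityMeasure_uniformOn Set.finite_univ Set.univ_nonempty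

end Watermelon

/-- The `k`-th (physicists') Hermite polynomial,
`H_k(z) = k! ∑_m (-1)^(k-m) / (k-m)! * (2z)^(2m-k) / (2m-k)!`, where `m` runs over the integers
with `k ≤ 2m` and `m ≤ k`, so that no subtraction below is truncated. -/
noncomputable def hermiteH (k : ℕ) (z : ℝ) : ℝ :=
  (k ! : ℝ) * ∑ m ∈ (Finset.range (k + 1)).filter (fun m => k ≤ 2 * m),
    (-1) ^ (k - m) / ((k - m) ! : ℝ) * ((2 * z) ^ (2 * m - k) / ((2 * m - k) ! : ℝ))

/-- The limiting distribution function of the normalised height of a `p`-watermelon. -/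
noncomputable def heightLimit (p : ℕ) (t : ℝ) : ℝ :=
  ((2 : ℝ) ^ p.choose 2)⁻¹ / (∏ j ∈ Finset.range p, (j ! : ℝ)) *
    Matrix.det (Matrix.of fun i j : Fin p =>
      (-1) ^ (i : ℕ) * hermiteH (i + j) 0 - hermiteH (i + j) t * Real.exp (-t ^ 2))

/-- The number of `±1`-walks of length `k` with total displacement `d`. -/
noncomputable def walkCount : ℕ → ℤ → ℝ
  | 0, d => if d = 0 then 1 else 0
  | k + 1, d => walkCount k (d - 1) + walkCount k (d + 1)

theorem walkCount_neg (k : ℕ) (d : ℤ) : walkCount k (-d) = walkCount k d := by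
  induction k generalizing d with
  | zero => simp [walkCount]
  | succ k ih =>
    rw [walkCount, walkCount, ← ih (d - 1), ← ih (d + 1), add_comm]
    congr 2 <;> ring

theorem walkCount_eq_zero {k : ℕ} {d : ℤ} (h : (k : ℤ) < d) : walkCount k d = 0 := by
  induction k generalizing d with
  | zero => rw [walkCount, if_neg]; omega
  | succ k ih => rw [walkCount, ih (by push_cast at h; omega), ih (by push_cast at h; omega), add_zero]

theorem walkCount_nonneg (k : ℕ) (d : ℤ) : 0 ≤ walkCount k d := by
  induction k generalizing d with
  | zero => rw [walkCount]; split_ifs <;> simp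
  | succ k ih => exact add_nonneg (ih _) (ih _)

theorem walkCount_pos (n : ℕ) : 0 < walkCount (2 * n) 0 := by
  induction n with
  | zero => simp [walkCount]
  | succ n ih =>
    have h1 := walkCount_nonneg (2 * n) (0 - 1 - 1)
    have h2 := walkCount_nonneg (2 * n) (0 + 1 + 1)
    have e : walkCount (2 * (n + 1)) 0 = walkCount (2 * n) (0 - 1 - 1)
        + walkCount (2 * n) (0 - 1 + 1) + (walkCount (2 * n) (0 + 1 - 1)
        + walkCount (2 * n) (0 + 1 + 1)) := rfl
    rw [e]
    norm_num at *
    linarith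

theorem walkCount_ratio (k : ℕ) (d : ℤ) :
    (k + d + 2) * walkCount k (d + 2) = (k - d) * walkCount k d := by
  induction k generalizing d with
  | zero =>
    simp only [walkCount]
    split_ifs with h1 h2 h2
    · omega
    · have : (d : ℝ) + 2 = 0 := by exact_mod_cast h1
      simp [this]
    · simp [h2]
    · simp
  | succ k ih =>
    have h1 := ih (d + 1)
    have h2 := ih (d - 1)
    rw [walkCount, walkCount]
    rw [show d + 1 + 2 = d + 2 + 1 by ring] at h1
    rw [show d - 1 + 2 = d + 1 by ring] at h2
    rw [show d + 2 - 1 = d + 1 by ring]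
    push_cast at *
    linear_combination h1 + h2

/-- Signed count of walks from `a` to `b`: those ending at the mirror image of `b` in the line of
ordinate `h` count negatively. -/
noncomputable def reflectedCount (h : ℤ) (k : ℕ) (a b : ℤ) : ℝ :=
  walkCount k (b - a) - walkCount k (2 * h - b - a)

theorem reflectedCount_succ (h : ℤ) (k : ℕ) (a b : ℤ) :
    reflectedCount h (k + 1) a b = reflectedCount h k (a + 1) b + reflectedCount h k (a - 1) b := by
  simp only [reflectedCount, walkCount]
  rw [show b - a - 1 = b - (a + 1) by ring, show b - a + 1 = b - (a - 1) by ring,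
    show 2 * h - b - a - 1 = 2 * h - b - (a + 1) by ring,
    show 2 * h - b - a + 1 = 2 * h - b - (a - 1) by ring]
  ring

theorem reflectedCount_self (h : ℤ) (k : ℕ) (b : ℤ) : reflectedCount h k h b = 0 := by
  rw [reflectedCount, ← walkCount_neg k (b - h), sub_eq_zero]
  congr 1
  ring

theorem reflectedCount_zero {h a b : ℤ} (ha : a < h) (hb : b < h) :
    reflectedCount h 0 a b = if a = b then 1 else 0 := by
  simp only [reflectedCount, walkCount]
  rw [if_neg (by omega : ¬ (2 * h - b - a = 0)), sub_zero]
  exact if_congr (by omega) rfl rfl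

/-- The families of `p` walks of length `k` from `x` to `y`, pairwise disjoint and below `h`. -/
def walkFamilies {p : ℕ} (h : ℤ) (y : Fin p → ℤ) (k : ℕ) (x : Fin p → ℤ) :
    Set (Fin (k + 1) → Fin p → ℤ) :=
  {γ | γ 0 = x ∧ γ (Fin.last k) = y ∧
    (∀ (j : Fin k) i, γ j.succ i = γ j.castSucc i + 1 ∨ γ j.succ i = γ j.castSucc i - 1) ∧
    ∀ j, Function.Injective (γ j) ∧ ∀ i, γ j i < h}

/-- Moves each coordinate of `x` up or down by one. -/
def stepBy {p : ℕ} (x : Fin p → ℤ) (e : Fin p → Bool) : Fin p → ℤ :=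
  fun i => bif e i then x i + 1 else x i - 1

theorem stepBy_injective {p : ℕ} (x : Fin p → ℤ) : Function.Injective (stepBy x) := by
  intro e e' h
  ext i
  have := congrFun h i
  simp only [stepBy] at this
  cases h1 : e i <;> cases h2 : e' i <;> simp [h1, h2] at this ⊢ <;> omega

theorem walkFamilies_succ {p : ℕ} {h : ℤ} {y : Fin p → ℤ} {k : ℕ} {x : Fin p → ℤ}
    (hx : Function.Injective x) (hxh : ∀ i, x i < h) :
    walkFamilies h y (k + 1) x =
      ⋃ e : Fin p → Bool, (fun γ => (Fin.cons x γ : Fin (k + 2) → Fin p → ℤ)) ''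
        walkFamilies h y k (stepBy x e) := by
  ext γ
  simp only [Set.mem_iUnion, Set.mem_image]
  constructor
  · rintro ⟨h0, h1, h2, h3⟩
    refine ⟨fun i => decide (γ 1 i = x i + 1), Fin.tail γ, ⟨?_, h1, ?_, fun j => h3 j.succ⟩, ?_⟩
    · ext i
      have := h2 0 i
      simp only [Fin.succ_zero_eq_one, Fin.castSucc_zero, h0] at this
      simp only [Fin.tail, Fin.succ_zero_eq_one, stepBy]
      by_cases hi : γ 1 i = x i + 1
      · simp [hi]
      · simp only [hi, decide_false, cond_false]
        omega
    · intro j i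
      exact h2 j.succ i
    · rw [← h0, Fin.cons_self_tail]
  · rintro ⟨e, δ, ⟨h0, h1, h2, h3⟩, rfl⟩
    refine ⟨Fin.cons_zero _ _, ?_, ?_, ?_⟩
    · rw [← Fin.succ_last, Fin.cons_succ, h1]
    · intro j i
      refine Fin.cases ?_ (fun j => ?_) j
      · simp only [Fin.succ_zero_eq_one, Fin.castSucc_zero, Fin.cons_zero]
        rw [← Fin.succ_zero_eq_one, Fin.cons_succ, h0]
        simp only [stepBy]
        cases e i <;> simp
      · rw [← Fin.succ_castSucc, Fin.cons_succ, Fin.cons_succ]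
        exact h2 j i
    · intro j
      refine Fin.cases ?_ (fun j => ?_) j
      · rw [Fin.cons_zero]
        exact ⟨hx, hxh⟩
      · rw [Fin.cons_succ]
        exact h3 j

theorem walkFamilies_eq_empty {p : ℕ} {h : ℤ} {y : Fin p → ℤ} {k : ℕ} {x : Fin p → ℤ}
    (hx : ¬ (Function.Injective x ∧ ∀ i, x i < h)) : walkFamilies h y k x = ∅ := by
  rw [Set.eq_empty_iff_forall_notMem]
  rintro γ ⟨h0, -, -, h3⟩
  exact hx (h0 ▸ h3 0)

theorem finite_walkFamilies {p : ℕ} (h : ℤ) (y : Fin p → ℤ) (k : ℕ) (x : Fin p → ℤ) :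
    (walkFamilies h y k x).Finite := by
  induction k generalizing x with
  | zero =>
    refine (Set.finite_singleton (fun _ => x)).subset ?_
    rintro γ ⟨h0, -⟩
    ext j i
    obtain rfl : j = 0 := by omega
    exact congrFun h0 i
  | succ k ih =>
    by_cases hx : Function.Injective x ∧ ∀ i, x i < h
    · rw [walkFamilies_succ hx.1 hx.2]
      exact Set.finite_iUnion fun e => (ih _).image _
    · rw [walkFamilies_eq_empty hx]
      exact Set.finite_empty

theorem ncard_walkFamilies_succ {p : ℕ} {h : ℤ} {y : Fin p → ℤ} {k : ℕ} {x : Fin p → ℤ}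
    (hx : Function.Injective x) (hxh : ∀ i, x i < h) :
    (walkFamilies h y (k + 1) x).ncard =
      ∑ e : Fin p → Bool, (walkFamilies h y k (stepBy x e)).ncard := by
  have hc : Function.Injective fun γ : Fin (k + 1) → Fin p → ℤ =>
      (Fin.cons x γ : Fin (k + 2) → Fin p → ℤ) :=
    fun _ _ h' => Fin.cons_right_injective (α := fun _ => Fin p → ℤ) x h'
  rw [walkFamilies_succ hx hxh, Set.ncard_iUnion_of_finite
    (fun e => (finite_walkFamilies h y k _).image _), finsum_eq_sum_of_fintype]
  · exact Finset.sum_congr rfl fun e _ =>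
      Set.ncard_image_of_injective _ hc
  · intro e e' hne
    rw [Function.onFun, Set.disjoint_left]
    rintro _ ⟨δ, hδ, rfl⟩ ⟨δ', hδ', h'⟩
    have : δ' = δ := hc h'
    subst this
    exact hne (stepBy_injective x (hδ.1.symm.trans hδ'.1))

theorem det_of_eq_zero_one {p : ℕ} {x y : Fin p → ℤ} (hx : StrictMono x) (hy : StrictMono y) :
    Matrix.det (Matrix.of fun i j : Fin p => if x i = y j then (1 : ℝ) else 0) =
      if x = y then 1 else 0 := by
  split_ifs with hxy
  · subst hxy
    rw [← Matrix.det_one (n := Fin p)]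
    congr 1
    ext i j
    simp [Matrix.one_apply, hx.injective.eq_iff]
  · by_cases hr : ∀ i, ∃ j, x i = y j
    · exfalso
      choose s hs using hr
      have hsm : StrictMono s := fun i j hij => by
        rw [← hy.lt_iff_lt, ← hs, ← hs]
        exact hx hij
      have hsur : Function.Surjective s := Finite.injective_iff_surjective.1 hsm.injective
      have : s = id := (hsm.range_inj strictMono_id).1 (by rw [hsur.range_eq, Set.range_id])
      exact hxy (funext fun i => by rw [hs, this]; rfl)
    · push Not at hr
      obtain ⟨i, hi⟩ := hr
      exact Matrix.det_eq_zero_of_row_eq_zero i fun j => by simp [hi j]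

/-- A determinantal count of non-intersecting walks that stay below the line of ordinate `h`. -/
theorem ncard_walkFamilies {p : ℕ} {h : ℤ} {y : Fin p → ℤ} (hy : StrictMono y)
    (hyh : ∀ i, y i < h) (k : ℕ) {x : Fin p → ℤ} (hx : StrictMono x)
    (hpar : ∀ i j, (2 : ℤ) ∣ x j - x i) (hxh : ∀ i, x i < h) :
    ((walkFamilies h y k x).ncard : ℝ) =
      Matrix.det (Matrix.of fun i j : Fin p => reflectedCount h k (x i) (y j)) := by
  induction k generalizing x with
  | zero =>
    simp only [reflectedCount_zero (hxh _) (hyh _)]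
    rw [det_of_eq_zero_one hx hy]
    split_ifs with hxy
    · have : walkFamilies h y 0 x = {fun _ => x} := by
        ext γ
        rw [Set.mem_singleton_iff]
        constructor
        · rintro ⟨h0, -⟩
          ext j i
          obtain rfl : j = 0 := by omega
          exact congrFun h0 i
        · rintro rfl
          exact ⟨rfl, hxy, fun j => j.elim0, fun _ => ⟨hx.injective, hxh⟩⟩
      rw [this, Set.ncard_singleton, Nat.cast_one]
    · have : walkFamilies h y 0 x = ∅ := by
        rw [Set.eq_empty_iff_forall_notMem]
        rintro γ ⟨h0, h1, -⟩
        exact hxy (h0.symm.trans h1)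
      rw [this, Set.ncard_empty, Nat.cast_zero]
  | succ k ih =>
    rw [ncard_walkFamilies_succ hx.injective hxh]
    have hdet := (Matrix.detRowAlternating (n := Fin p) (R := ℝ)).toMultilinearMap.map_sum
      (fun (i : Fin p) (b : Bool) (j : Fin p) =>
        reflectedCount h k (bif b then x i + 1 else x i - 1) (y j))
    have hrows : (Matrix.of fun i j : Fin p => reflectedCount h (k + 1) (x i) (y j)) =
        fun i => ∑ b : Bool, fun j : Fin p =>
          reflectedCount h k (bif b then x i + 1 else x i - 1) (y j) := by
      ext i j
      simp [reflectedCount_succ]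
    rw [hrows]
    refine Eq.trans ?_ hdet.symm
    push_cast
    refine Finset.sum_congr rfl fun e _ => ?_
    change _ = Matrix.det (Matrix.of fun i j : Fin p => reflectedCount h k (stepBy x e i) (y j))
    have hmono : ∀ i j, i < j → stepBy x e i ≤ stepBy x e j := by
      intro i j hij
      have h1 := hx hij
      have h2 := hpar i j
      simp only [stepBy]
      cases e i <;> cases e j <;> simp only [cond_true, cond_false] <;> omega
    by_cases hinj : Function.Injective (stepBy x e)
    · by_cases hlt : ∀ i, stepBy x e i < h
      · refine ih (fun i j hij => lt_of_le_of_ne (hmono i j hij) (hinj.ne hij.ne)) ?_ hlt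
        intro i j
        have h2 := hpar i j
        simp only [stepBy]
        cases e i <;> cases e j <;> simp only [cond_true, cond_false] <;> omega
      · rw [walkFamilies_eq_empty fun hc => hlt hc.2, Set.ncard_empty, Nat.cast_zero]
        push Not at hlt
        obtain ⟨i, hi⟩ := hlt
        have : stepBy x e i = h := by
          have := hxh i
          simp only [stepBy] at hi ⊢
          cases h' : e i <;> simp only [h', cond_true, cond_false] at hi ⊢ <;> omega
        refine (Matrix.det_eq_zero_of_row_eq_zero i fun j => ?_).symm
        rw [Matrix.of_apply, this, reflectedCount_self]
    · rw [walkFamilies_eq_empty fun hc => hinj hc.1, Set.ncard_empty, Nat.cast_zero]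
      simp only [Function.Injective] at hinj
      push Not at hinj
      obtain ⟨i, j, hij, hne⟩ := hinj
      exact (Matrix.det_zero_of_row_eq hne (by ext l; simp [hij])).symm

namespace Watermelon

variable {p n : ℕ}

theorem even_path_sub (w : Watermelon p n) (k : Fin (2 * n + 1)) (i j : Fin p) :
    (2 : ℤ) ∣ w.path j k - w.path i k := by
  induction k using Fin.induction with
  | zero => rw [w.start_eq, w.start_eq]; omega
  | succ k ih =>
    have h1 := w.step i k
    have h2 := w.step j k
    omega

theorem strictMono_path (w : Watermelon p n) (k : Fin (2 * n + 1)) :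
    StrictMono fun i => w.path i k := by
  induction k using Fin.induction with
  | zero =>
    intro i j hij
    simp only [w.start_eq]
    have : (i : ℕ) < j := hij
    omega
  | succ k ih =>
    intro i j hij
    have h0 := ih hij
    have h1 := w.step i k
    have h2 := w.step j k
    have h3 := w.even_path_sub k.castSucc i j
    have h4 := w.nonintersecting i j hij.ne k.succ
    simp only at h0 ⊢
    omega

theorem height_lt_iff (hp : 0 < p) (w : Watermelon p n) (h : ℤ) :
    w.height hp < h ↔ ∀ k i, w.path i k < h := by
  rw [height, Finset.sup'_lt_iff]
  constructor
  · intro H k i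
    refine lt_of_le_of_lt ((w.strictMono_path k).monotone ?_) (H k (Finset.mem_univ k))
    rw [Fin.le_def]
    have := i.2
    simp only
    omega
  · intro H k _
    exact H k _

theorem path_le (w : Watermelon p n) (k : Fin (2 * n + 1)) (i : Fin p) :
    w.path i k ≤ 2 * (i : ℤ) + (k : ℕ) := by
  induction k using Fin.induction with
  | zero => rw [w.start_eq]; simp
  | succ k ih =>
    have h1 := w.step i k
    simp only [Fin.val_succ, Fin.val_castSucc] at ih ⊢
    push_cast
    omega

theorem ncard_height_lt (hp : 0 < p) (n : ℕ) {h : ℤ} (hh : 2 * (p : ℤ) ≤ h) :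
    ({w : Watermelon p n | w.height hp < h}.ncard : ℝ) =
      Matrix.det (Matrix.of fun i j : Fin p => walkCount (2 * n) (2 * ((j : ℤ) - i))
        - walkCount (2 * n) (2 * (h - i - j))) := by
  have hy : StrictMono fun i : Fin p => 2 * ((i : ℕ) : ℤ) := by
    intro i j hij
    have : (i : ℕ) < j := hij
    simp only
    omega
  have hyh : ∀ i : Fin p, 2 * ((i : ℕ) : ℤ) < h := fun i => by have := i.2; omega
  have key := ncard_walkFamilies hy hyh (2 * n) hy (fun i j => by omega) hyh
  simp only [reflectedCount] at key
  have himg : (fun (w : Watermelon p n) k i => w.path i k) '' {w | w.height hp < h} =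
      walkFamilies h (fun i : Fin p => 2 * ((i : ℕ) : ℤ)) (2 * n)
        (fun i : Fin p => 2 * ((i : ℕ) : ℤ)) := by
    ext γ
    constructor
    · rintro ⟨w, hw, rfl⟩
      refine ⟨funext w.start_eq, funext w.end_eq, fun k i => w.step i k, fun k => ?_⟩
      exact ⟨(w.strictMono_path k).injective, (w.height_lt_iff hp h).1 hw k⟩
    · rintro ⟨h0, h1, h2, h3⟩
      refine ⟨⟨fun i k => γ k i, fun i => congrFun h0 i, fun i => congrFun h1 i,
        fun i k => h2 k i, fun i j hij k => (h3 k).1.ne hij⟩, ?_, rfl⟩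
      exact (height_lt_iff hp _ h).2 fun k i => (h3 k).2 i
  rw [← Set.ncard_image_of_injective (f := fun (w : Watermelon p n) k i => w.path i k), himg, key]
  · congr 1
    ext i j
    simp only [Matrix.of_apply]
    congr 2 <;> ring
  · intro w v hwv
    ext i k
    exact congrFun (congrFun hwv k) i

theorem card_eq_det (hp : 0 < p) (n : ℕ) :
    (Nat.card (Watermelon p n) : ℝ) =
      Matrix.det (Matrix.of fun i j : Fin p => walkCount (2 * n) (2 * ((j : ℤ) - i))) := by
  have h := ncard_height_lt hp n (h := 2 * n + 2 * p) (by omega)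
  rw [Set.eq_univ_of_forall (s := {w : Watermelon p n | w.height hp < 2 * n + 2 * p}),
    Set.ncard_univ] at h
  · rw [h]
    congr 1
    ext i j
    have := i.2
    have := j.2
    rw [Matrix.of_apply, Matrix.of_apply, walkCount_eq_zero (d := 2 * (_ - _ - _))
      (by push_cast; omega), sub_zero]
  · intro w
    refine (height_lt_iff hp w _).2 fun k i => ?_
    have := w.path_le k i
    have := k.2
    have := i.2
    omega

theorem uniform_real_eq (s : Set (Watermelon p n)) :
    (uniform p n).real s = s.ncard / Nat.card (Watermelon p n) := by
  have := Fintype.ofFinite (Watermelon p n)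
  rw [MeasureTheory.Measure.real, uniform, ProbabilityTheory.uniformOn_univ,
    MeasureTheory.Measure.count_apply_finite _ s.toFinite, ENNReal.toReal_div,
    Set.ncard_eq_toFinset_card s s.toFinite, Nat.card_eq_fintype_card]
  simp

end Watermelon

/-- The summands of the Hermite polynomial `hermiteH k`, extended by zero. -/
noncomputable def hermiteTerm (k m : ℕ) (z : ℝ) : ℝ :=
  if k ≤ 2 * m ∧ m ≤ k then
    (-1) ^ (k - m) / ((k - m) ! : ℝ) * ((2 * z) ^ (2 * m - k) / ((2 * m - k) ! : ℝ)) else 0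

theorem hermiteH_eq_sum_hermiteTerm {k N : ℕ} (hN : k < N) (z : ℝ) :
    hermiteH k z = (k ! : ℝ) * ∑ m ∈ Finset.range N, hermiteTerm k m z := by
  rw [hermiteH, Finset.sum_filter]
  congr 1
  rw [← Finset.sum_subset (Finset.range_subset_range.2 hN)]
  · refine Finset.sum_congr rfl fun m hm => ?_
    rw [hermiteTerm]
    refine if_congr ?_ rfl rfl
    rw [Finset.mem_range] at hm
    omega
  · intro m _ hm
    rw [Finset.mem_range] at hm
    rw [hermiteTerm, if_neg (by omega)]

theorem hermiteTerm_succ_succ (k m : ℕ) (z : ℝ) :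
    (k + 2) * hermiteTerm (k + 2) (m + 1) z =
      2 * z * hermiteTerm (k + 1) m z - 2 * hermiteTerm k m z := by
  by_cases h : k ≤ 2 * m ∧ m ≤ k + 1
  · obtain ⟨l, hl⟩ := Nat.exists_eq_add_of_le h.1
    obtain ⟨j, hj⟩ := Nat.exists_eq_add_of_le h.2
    have hk : (k : ℝ) + 2 = 2 * j + l := by
      have : k + 2 = 2 * j + l := by omega
      exact_mod_cast this
    rw [hk]
    simp only [hermiteTerm]
    rw [if_pos (by omega), show k + 2 - (m + 1) = j by omega, show 2 * (m + 1) - (k + 2) = l by omega]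
    have h1 : (if k + 1 ≤ 2 * m ∧ m ≤ k + 1 then (-1) ^ (k + 1 - m) / ((k + 1 - m) ! : ℝ) *
        ((2 * z) ^ (2 * m - (k + 1)) / ((2 * m - (k + 1)) ! : ℝ)) else 0) * (2 * z) =
        l * ((-1) ^ j / (j ! : ℝ) * ((2 * z) ^ l / (l ! : ℝ))) := by
      rcases l with _ | l
      · rw [if_neg (by omega)]; simp
      · rw [if_pos (by omega), show k + 1 - m = j by omega, show 2 * m - (k + 1) = l by omega,
          Nat.factorial_succ]
        push_cast
        field_simp
        ring
    have h2 : (if k ≤ 2 * m ∧ m ≤ k then (-1) ^ (k - m) / ((k - m) ! : ℝ) *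
        ((2 * z) ^ (2 * m - k) / ((2 * m - k) ! : ℝ)) else 0) =
        -(j * ((-1) ^ j / (j ! : ℝ) * ((2 * z) ^ l / (l ! : ℝ)))) := by
      rcases j with _ | j
      · rw [if_neg (by omega)]; simp
      · rw [if_pos (by omega), show k - m = j by omega, show 2 * m - k = l by omega,
          Nat.factorial_succ]
        push_cast
        field_simp
        ring
    rw [h2]
    linear_combination -h1
  · simp only [hermiteTerm]
    rw [if_neg (by omega), if_neg (by omega), if_neg (by omega)]
    ring

theorem hermiteH_zero (z : ℝ) : hermiteH 0 z = 1 := by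
  simp [hermiteH_eq_sum_hermiteTerm Nat.zero_lt_one, hermiteTerm]

theorem hermiteH_one (z : ℝ) : hermiteH 1 z = 2 * z := by
  simp [hermiteH_eq_sum_hermiteTerm Nat.one_lt_two, hermiteTerm, Finset.sum_range_succ]

theorem hermiteH_add_two (k : ℕ) (z : ℝ) :
    hermiteH (k + 2) z = 2 * z * hermiteH (k + 1) z - 2 * (k + 1) * hermiteH k z := by
  rw [hermiteH_eq_sum_hermiteTerm (N := k + 3) (by omega),
    hermiteH_eq_sum_hermiteTerm (N := k + 2) (by omega),
    hermiteH_eq_sum_hermiteTerm (N := k + 2) (by omega), Finset.sum_range_succ']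
  have h0 : hermiteTerm (k + 2) 0 z = 0 := by rw [hermiteTerm, if_neg (by omega)]
  have hs : (k + 2) * ∑ m ∈ Finset.range (k + 2), hermiteTerm (k + 2) (m + 1) z =
      2 * z * ∑ m ∈ Finset.range (k + 2), hermiteTerm (k + 1) m z -
        2 * ∑ m ∈ Finset.range (k + 2), hermiteTerm k m z := by
    simp only [Finset.mul_sum, ← Finset.sum_sub_distrib, hermiteTerm_succ_succ]
  rw [h0, Nat.factorial_succ, Nat.factorial_succ]
  push_cast
  linear_combination ((k : ℝ) + 1) * (k ! : ℝ) * hs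

/-- The unitriangular factor of the Hankel matrix of the numbers `hermiteH k 0`. -/
noncomputable def hermiteFactor (n k : ℕ) : ℝ := n.choose k * hermiteH (n - k) 0

theorem hermiteH_succ_zero (m : ℕ) : hermiteH (m + 1) 0 = -(2 * m) * hermiteH (m - 1) 0 := by
  rcases m with _ | m
  · simp [hermiteH_one]
  · rw [hermiteH_add_two]
    push_cast
    simp

theorem hermiteFactor_succ_zero (n : ℕ) :
    hermiteFactor (n + 1) 0 = -2 * hermiteFactor n 1 := by
  simp only [hermiteFactor, Nat.choose_zero_right, Nat.choose_one_right]
  rw [Nat.sub_zero, hermiteH_succ_zero]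
  push_cast
  ring

theorem hermiteFactor_succ_succ (n k : ℕ) :
    hermiteFactor (n + 1) (k + 1) =
      hermiteFactor n k - 2 * (k + 2) * hermiteFactor n (k + 2) := by
  simp only [hermiteFactor]
  rcases Nat.lt_or_ge n (k + 1) with h | h
  · rw [Nat.choose_succ_succ, Nat.choose_eq_zero_of_lt h, Nat.choose_eq_zero_of_lt (by omega : n < k + 2)]
    simp
  · obtain ⟨m, rfl⟩ := Nat.exists_eq_add_of_le h
    have h1 := Nat.choose_succ_right_eq (k + 1 + m) (k + 1)
    rw [show k + 1 + m - (k + 1) = m by omega] at h1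
    have h2 : ((k + 1 + m).choose (k + 2) : ℝ) * (k + 2) = (k + 1 + m).choose (k + 1) * m := by
      exact_mod_cast h1
    rw [Nat.choose_succ_succ, show k + 1 + m + 1 - (k + 1) = m + 1 by omega,
      show k + 1 + m - k = m + 1 by omega, show k + 1 + m - (k + 2) = m - 1 by omega,
      hermiteH_succ_zero]
    push_cast
    linear_combination 2 * hermiteH (m - 1) 0 * h2

theorem hermiteFactor_eq_zero {n k : ℕ} (h : n < k) : hermiteFactor n k = 0 := by
  rw [hermiteFactor, Nat.choose_eq_zero_of_lt h, Nat.cast_zero, zero_mul]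

theorem hermiteFactor_self (n : ℕ) : hermiteFactor n n = 1 := by
  simp [hermiteFactor, hermiteH_zero]

theorem sum_hermiteFactor_succ_left {i j N : ℕ} (hi : i < N) (hj : j < N) :
    ∑ k ∈ Finset.range (N + 1), hermiteFactor (i + 1) k * ((-2) ^ k * (k ! : ℝ)) * hermiteFactor j k
      = ∑ k ∈ Finset.range N, (-2) ^ (k + 1) * ((k + 1) ! : ℝ) *
        (hermiteFactor i k * hermiteFactor j (k + 1) +
          hermiteFactor i (k + 1) * hermiteFactor j k) := by
  have e : ∑ k ∈ Finset.range N, (-2) ^ (k + 1) * ((k + 1) ! : ℝ) *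
      (hermiteFactor i (k + 1) * hermiteFactor j k) =
      ∑ k ∈ Finset.range N, (-2) ^ (k + 2) * ((k + 2) ! : ℝ) *
      (hermiteFactor i (k + 2) * hermiteFactor j (k + 1)) +
      -2 * (hermiteFactor i 1 * hermiteFactor j 0) := by
    obtain ⟨M, rfl⟩ : ∃ M, N = M + 1 := ⟨N - 1, by omega⟩
    rw [Finset.sum_range_succ', Finset.sum_range_succ (n := M),
      hermiteFactor_eq_zero (by omega : i < M + 2)]
    simp
  simp only [mul_add, Finset.sum_add_distrib]
  rw [e, Finset.sum_range_succ', ← add_assoc, ← Finset.sum_add_distrib]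
  congr 1
  · refine Finset.sum_congr rfl fun k _ => ?_
    rw [hermiteFactor_succ_succ, Nat.factorial_succ (k + 1)]
    push_cast
    ring
  · rw [hermiteFactor_succ_zero]
    simp
    ring

theorem sum_hermiteFactor {i j N : ℕ} (hi : i < N) (hj : j < N) :
    ∑ k ∈ Finset.range N, hermiteFactor i k * ((-2) ^ k * (k ! : ℝ)) * hermiteFactor j k =
      hermiteH (i + j) 0 := by
  have extend : ∀ {i j N M : ℕ}, j < N → N ≤ M →
      ∑ k ∈ Finset.range N, hermiteFactor i k * ((-2) ^ k * (k ! : ℝ)) * hermiteFactor j k =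
      ∑ k ∈ Finset.range M, hermiteFactor i k * ((-2) ^ k * (k ! : ℝ)) * hermiteFactor j k := by
    intro i j N M hj hNM
    refine Finset.sum_subset (Finset.range_subset_range.2 hNM) fun k _ hk => ?_
    rw [Finset.mem_range] at hk
    rw [hermiteFactor_eq_zero (by omega : j < k), mul_zero]
  induction j generalizing i N with
  | zero =>
    obtain ⟨M, rfl⟩ : ∃ M, N = M + 1 := ⟨N - 1, by omega⟩
    rw [Finset.sum_eq_single_of_mem 0 (by simp)]
    · rw [hermiteFactor_self]
      simp [hermiteFactor]
    · intro k _ hk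
      rw [hermiteFactor_eq_zero (by omega : 0 < k), mul_zero]
  | succ j ih =>
    have h1 := ih (i := i + 1) (N := N + 1 + 1) (by omega) (by omega)
    rw [extend hj (by omega : N ≤ N + 1 + 1), show i + (j + 1) = i + 1 + j by ring, ← h1,
      sum_hermiteFactor_succ_left (by omega) (by omega)]
    have h2 := sum_hermiteFactor_succ_left (i := j) (j := i) (N := N + 1) (by omega) (by omega)
    have h3 : ∀ k, hermiteFactor i k * ((-2) ^ k * (k ! : ℝ)) * hermiteFactor (j + 1) k =
        hermiteFactor (j + 1) k * ((-2) ^ k * (k ! : ℝ)) * hermiteFactor i k := fun k => by ring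
    simp only [h3]
    rw [h2]
    exact Finset.sum_congr rfl fun k _ => by ring

theorem det_hermiteH_zero (p : ℕ) :
    Matrix.det (Matrix.of fun i j : Fin p => (-1) ^ (i : ℕ) * hermiteH (i + j) 0) =
      2 ^ p.choose 2 * ∏ j ∈ Finset.range p, (j ! : ℝ) := by
  have hdet : Matrix.det (Matrix.of fun i j : Fin p => hermiteFactor i j) = 1 := by
    rw [Matrix.det_of_isLowerTriangular]
    · simp [hermiteFactor_self]
    · intro i j hij
      exact hermiteFactor_eq_zero hij
  have hfac : (Matrix.of fun i j : Fin p => hermiteH (i + j) 0) =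
      (Matrix.of fun i j : Fin p => hermiteFactor i j) *
        Matrix.diagonal (fun k : Fin p => (-2 : ℝ) ^ (k : ℕ) * ((k : ℕ) ! : ℝ)) *
        (Matrix.of fun i j : Fin p => hermiteFactor i j).transpose := by
    ext i j
    rw [Matrix.mul_apply]
    simp only [Matrix.mul_diagonal, Matrix.of_apply, Matrix.transpose_apply]
    rw [← sum_hermiteFactor i.2 j.2, Finset.sum_range]
  have := Matrix.det_mul_column (fun i : Fin p => (-1 : ℝ) ^ (i : ℕ))
    (Matrix.of fun i j : Fin p => hermiteH (i + j) 0)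
  simp only [Matrix.of_apply] at this
  rw [this, hfac, Matrix.det_mul, Matrix.det_mul, Matrix.det_transpose, hdet, Matrix.det_diagonal,
    one_mul, mul_one, ← Finset.prod_mul_distrib]
  have h2 : ∀ i : Fin p, (-1 : ℝ) ^ (i : ℕ) * ((-2) ^ (i : ℕ) * ((i : ℕ) ! : ℝ)) =
      2 ^ (i : ℕ) * ((i : ℕ) ! : ℝ) := by
    intro i
    rw [← mul_assoc, ← mul_pow]
    norm_num
  simp only [h2]
  rw [Finset.prod_mul_distrib, ← Finset.prod_range (fun i => (2 : ℝ) ^ i),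
    ← Finset.prod_range (fun i => (i ! : ℝ)), Finset.prod_pow_eq_pow_sum, Finset.sum_range_id,
    Nat.choose_two_right]

/-- `f n = c + O(n^{-1/2})` as `n → ∞`. -/
def Approx (f : ℕ → ℝ) (c : ℝ) : Prop :=
  (fun n => f n - c) =O[atTop] fun n : ℕ => (√(n : ℝ))⁻¹

theorem tendsto_inv_sqrt_natCast : Tendsto (fun n : ℕ => (√(n : ℝ))⁻¹) atTop (nhds 0) :=
  (Real.tendsto_sqrt_atTop.comp tendsto_natCast_atTop_atTop).inv_tendsto_atTop

namespace Approx

variable {f g : ℕ → ℝ} {c d : ℝ}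

theorem tendsto (hf : Approx f c) : Tendsto f atTop (nhds c) :=
  tendsto_sub_nhds_zero_iff.1 (hf.trans_tendsto tendsto_inv_sqrt_natCast)

theorem congr' (hf : Approx f c) (h : ∀ᶠ n in atTop, f n = g n) : Approx g c :=
  IsBigO.congr' hf (h.mono fun n hn => by simp only [hn]) EventuallyEq.rfl

theorem const (c : ℝ) : Approx (fun _ => c) c := by
  simpa [Approx] using isBigO_zero _ _

theorem inv_sqrt : Approx (fun n => (√(n : ℝ))⁻¹) 0 := by
  simpa [Approx] using isBigO_refl _ _

theorem add (hf : Approx f c) (hg : Approx g d) : Approx (fun n => f n + g n) (c + d) :=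
  (IsBigO.add hf hg).congr_left fun n => by ring

theorem mul (hf : Approx f c) (hg : Approx g d) : Approx (fun n => f n * g n) (c * d) := by
  have h1 : (fun n => (f n - c) * g n) =O[atTop] fun n : ℕ => (√(n : ℝ))⁻¹ := by
    simpa using IsBigO.mul hf (hg.tendsto.isBigO_one ℝ)
  exact (h1.add (IsBigO.const_mul_left hg c)).congr_left fun n => by ring

theorem const_mul (b : ℝ) (hf : Approx f c) : Approx (fun n => b * f n) (b * c) :=
  (const b).mul hf

theorem neg (hf : Approx f c) : Approx (fun n => -f n) (-c) := by
  simpa using hf.const_mul (-1)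

theorem sub (hf : Approx f c) (hg : Approx g d) : Approx (fun n => f n - g n) (c - d) := by
  simpa [sub_eq_add_neg] using hf.add hg.neg

theorem comp_differentiableAt {F : ℝ → ℝ} (hf : Approx f c) (hF : DifferentiableAt ℝ F c) :
    Approx (fun n => F (f n)) (F c) :=
  (hF.isBigO_sub.comp_tendsto hf.tendsto).trans hf

theorem div (hf : Approx f c) (hg : Approx g d) (hd : d ≠ 0) :
    Approx (fun n => f n / g n) (c / d) := by
  simpa only [div_eq_mul_inv] using hf.mul (hg.comp_differentiableAt (differentiableAt_inv hd))

theorem abs (hf : Approx f c) : Approx (fun n => |f n|) |c| :=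
  (IsBigO.of_bound 1 (Eventually.of_forall fun n => by
    simpa using abs_abs_sub_abs_le (f n) c)).trans hf

theorem squeeze {l u : ℕ → ℝ} (hl : Approx l c) (hu : Approx u c)
    (h1 : ∀ᶠ n in atTop, l n ≤ f n) (h2 : ∀ᶠ n in atTop, f n ≤ u n) : Approx f c := by
  refine IsBigO.trans (IsBigO.of_bound 1 ?_) (IsBigO.add (IsBigO.norm_left hl) (IsBigO.norm_left hu))
  filter_upwards [h1, h2] with n h1 h2
  rw [one_mul, Real.norm_eq_abs, Real.norm_eq_abs, Real.norm_eq_abs, Real.norm_eq_abs,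
    abs_of_nonneg (add_nonneg (abs_nonneg (l n - c)) (abs_nonneg (u n - c))), abs_le]
  have := neg_abs_le (l n - c)
  have := le_abs_self (u n - c)
  have := abs_nonneg (l n - c)
  have := abs_nonneg (u n - c)
  constructor <;> linarith

theorem sum {ι : Type*} (s : Finset ι) {f : ι → ℕ → ℝ} {c : ι → ℝ}
    (h : ∀ i ∈ s, Approx (f i) (c i)) : Approx (fun n => ∑ i ∈ s, f i n) (∑ i ∈ s, c i) := by
  classical
  induction s using Finset.induction_on with
  | empty => simpa using const 0
  | insert a s ha ih =>
    simp only [Finset.sum_insert ha]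
    exact (h a (by simp)).add (ih fun i hi => h i (by simp [hi]))

theorem prod {ι : Type*} (s : Finset ι) {f : ι → ℕ → ℝ} {c : ι → ℝ}
    (h : ∀ i ∈ s, Approx (f i) (c i)) : Approx (fun n => ∏ i ∈ s, f i n) (∏ i ∈ s, c i) := by
  classical
  induction s using Finset.induction_on with
  | empty => simpa using const 1
  | insert a s ha ih =>
    simp only [Finset.prod_insert ha]
    exact (h a (by simp)).mul (ih fun i hi => h i (by simp [hi]))

theorem det {p : ℕ} {A : ℕ → Matrix (Fin p) (Fin p) ℝ} {M : Matrix (Fin p) (Fin p) ℝ}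
    (h : ∀ i j, Approx (fun n => A n i j) (M i j)) : Approx (fun n => (A n).det) M.det := by
  simp only [Matrix.det_apply']
  exact sum _ fun s _ => (prod _ fun i _ => h _ _).const_mul _

end Approx

/-- The number of walks of length `2n` with displacement `2m`, relative to that of closed ones. -/
noncomputable def relativeCount (n : ℕ) (m : ℤ) : ℝ := walkCount (2 * n) (2 * m) / walkCount (2 * n) 0

theorem relativeCount_neg (n : ℕ) (m : ℤ) : relativeCount n (-m) = relativeCount n m := by
  rw [relativeCount, mul_neg, walkCount_neg, relativeCount]

theorem relativeCount_zero (n : ℕ) : relativeCount n 0 = 1 := by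
  rw [relativeCount, mul_zero, div_self (walkCount_pos n).ne']

theorem relativeCount_nonneg (n : ℕ) (m : ℤ) : 0 ≤ relativeCount n m :=
  div_nonneg (walkCount_nonneg _ _) (walkCount_nonneg _ _)

theorem relativeCount_add_one (n : ℕ) (m : ℤ) :
    (n + m + 1) * relativeCount n (m + 1) = (n - m) * relativeCount n m := by
  have h := walkCount_ratio (2 * n) (2 * m)
  have := (walkCount_pos n).ne'
  rw [relativeCount, relativeCount, mul_add, mul_one]
  field_simp
  push_cast at h
  linear_combination h / 2

theorem relativeCount_le (n H : ℕ) {h : ℕ} (hh : h ≤ H) (hH : H ≤ n) :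
    relativeCount n h ≤ Real.exp (-((h : ℝ) ^ 2 / (n + H))) := by
  induction h with
  | zero => simp [relativeCount_zero]
  | succ h ih =>
    have hr := relativeCount_add_one n h
    have hH' : (h : ℝ) + 1 ≤ H := by exact_mod_cast hh
    have hn' : (H : ℝ) ≤ n := by exact_mod_cast hH
    have h0 : (0 : ℝ) ≤ h := by positivity
    have hpos : (0 : ℝ) < n + h + 1 := by positivity
    have e : relativeCount n ((h + 1 : ℕ) : ℤ) =
        (1 + -((2 * h + 1) / (n + h + 1))) * relativeCount n h := by
      push_cast at hr ⊢
      field_simp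
      linear_combination hr
    have hexp : 1 + -((2 * h + 1) / (n + h + 1) : ℝ) ≤ Real.exp (-((2 * h + 1) / (n + H))) := by
      have h1 := Real.add_one_le_exp (-((2 * h + 1) / (n + h + 1) : ℝ))
      have h2 : (2 * h + 1 : ℝ) / (n + H) ≤ (2 * h + 1) / (n + h + 1) :=
        div_le_div_of_nonneg_left (by positivity) hpos (by linarith)
      have h3 := Real.exp_le_exp.2 (neg_le_neg h2)
      linarith
    rw [e]
    calc _ ≤ Real.exp (-((2 * h + 1) / (n + H))) * Real.exp (-((h : ℝ) ^ 2 / (n + H))) :=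
          mul_le_mul hexp (ih (by omega)) (relativeCount_nonneg _ _) (Real.exp_pos _).le
      _ = _ := by
          rw [← Real.exp_add]
          congr 1
          push_cast
          ring

theorem le_relativeCount (n H : ℕ) {h : ℕ} (hh : h ≤ H) (hH : H < n) :
    Real.exp (-((h : ℝ) ^ 2 / (n - H))) ≤ relativeCount n h := by
  induction h with
  | zero => simp [relativeCount_zero]
  | succ h ih =>
    have hr := relativeCount_add_one n h
    have hH' : (h : ℝ) + 1 ≤ H := by exact_mod_cast hh
    have hn' : (H : ℝ) < n := by exact_mod_cast hH
    have h0 : (0 : ℝ) ≤ h := by positivity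
    have hpos : (0 : ℝ) < n - h := by linarith
    have e : (1 + (2 * h + 1) / (n - h)) * relativeCount n ((h + 1 : ℕ) : ℤ) =
        relativeCount n h := by
      push_cast at hr ⊢
      field_simp
      linear_combination hr
    have hexp : 1 + ((2 * h + 1) / (n - h) : ℝ) ≤ Real.exp ((2 * h + 1) / (n - H)) := by
      have h1 := Real.add_one_le_exp ((2 * h + 1) / (n - h) : ℝ)
      have h2 : (2 * h + 1 : ℝ) / (n - h) ≤ (2 * h + 1) / (n - H) := by
        gcongr
        linarith
      have h3 := Real.exp_le_exp.2 h2
      linarith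
    have key : relativeCount n h ≤
        Real.exp ((2 * h + 1) / (n - H)) * relativeCount n ((h + 1 : ℕ) : ℤ) := by
      rw [← e]
      exact mul_le_mul_of_nonneg_right hexp (relativeCount_nonneg _ _)
    calc _ = Real.exp (-((2 * h + 1) / (n - H))) * Real.exp (-((h : ℝ) ^ 2 / (n - H))) := by
          rw [← Real.exp_add]
          congr 1
          push_cast
          ring
      _ ≤ Real.exp (-((2 * h + 1) / (n - H))) *
          (Real.exp ((2 * h + 1) / (n - H)) * relativeCount n ((h + 1 : ℕ) : ℤ)) :=
          mul_le_mul_of_nonneg_left ((ih (by omega)).trans key) (Real.exp_pos _).le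
      _ = _ := by rw [← mul_assoc, ← Real.exp_add, neg_add_cancel, Real.exp_zero, one_mul]

theorem relativeCount_natAbs (n : ℕ) (m : ℤ) : relativeCount n m.natAbs = relativeCount n m := by
  rcases Int.natAbs_eq m with h | h
  · rw [← h]
  · conv_rhs => rw [h, relativeCount_neg]

theorem approx_relativeCount {m : ℕ → ℤ} {x : ℝ} (hm : Approx (fun n => m n / √(n : ℝ)) x) :
    Approx (fun n => relativeCount n (m n)) (Real.exp (-x ^ 2)) := by
  have ha : Approx (fun n => |m n / √(n : ℝ)| * (√(n : ℝ))⁻¹) 0 := by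
    simpa using hm.abs.mul Approx.inv_sqrt
  have hsq : Approx (fun n => (m n / √(n : ℝ)) * (m n / √(n : ℝ))) (x ^ 2) := by
    simpa [sq] using hm.mul hm
  have hpos : ∀ᶠ n : ℕ in atTop, 0 < √(n : ℝ) :=
    (eventually_gt_atTop 0).mono fun n hn => by positivity
  have hlt : ∀ᶠ n : ℕ in atTop, (m n).natAbs < n := by
    filter_upwards [hpos, ha.tendsto.eventually_lt_const one_pos] with n hn h
    rw [abs_div, abs_of_pos hn, div_mul_eq_mul_div, ← div_eq_mul_inv, div_div,
      Real.mul_self_sqrt (Nat.cast_nonneg n), div_lt_one (by rwa [Real.sqrt_pos] at hn)] at h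
    rw [← Nat.cast_lt (α := ℝ), Nat.cast_natAbs, Int.cast_abs]
    exact h
  have key : ∀ s : ℝ, Approx (fun n => Real.exp (-((m n / √(n : ℝ)) * (m n / √(n : ℝ)) /
      (1 + s * (|m n / √(n : ℝ)| * (√(n : ℝ))⁻¹))))) (Real.exp (-x ^ 2)) := by
    intro s
    have h1 : Approx (fun n => 1 + s * (|m n / √(n : ℝ)| * (√(n : ℝ))⁻¹)) 1 := by
      simpa using (Approx.const 1).add (ha.const_mul s)
    have := (hsq.div h1 one_ne_zero).neg
    rw [div_one] at this
    exact this.comp_differentiableAt Real.differentiable_exp.differentiableAt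
  have rw_key : ∀ s : ℝ, ∀ n : ℕ, 0 < √(n : ℝ) →
      (m n / √(n : ℝ)) * (m n / √(n : ℝ)) / (1 + s * (|m n / √(n : ℝ)| * (√(n : ℝ))⁻¹)) =
      ((m n).natAbs : ℝ) ^ 2 / (n + s * (m n).natAbs) := by
    intro s n hn
    have hr : √(n : ℝ) ^ 2 = n := Real.sq_sqrt (Nat.cast_nonneg n)
    rw [abs_div, abs_of_pos hn, Nat.cast_natAbs, Int.cast_abs, sq_abs]
    have h1 : (n : ℝ) + s * |(m n : ℝ)| = √(n : ℝ) ^ 2 * (1 + s * (|(m n : ℝ)| / √(n : ℝ) * (√(n : ℝ))⁻¹)) := by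
      field_simp
      rw [hr]
    rw [h1, ← div_div]
    congr 1
    field_simp
  refine Approx.squeeze (key (-1)) (key 1) ?_ ?_
  · filter_upwards [hpos, hlt] with n hn h
    rw [rw_key (-1) n hn, ← relativeCount_natAbs]
    have := le_relativeCount n _ le_rfl h
    rwa [sub_eq_add_neg, ← neg_one_mul (((m n).natAbs : ℕ) : ℝ)] at this
  · filter_upwards [hpos, hlt] with n hn h
    rw [rw_key 1 n hn, ← relativeCount_natAbs, one_mul]
    exact relativeCount_le n _ le_rfl h.le

theorem fwdDiff_iterate_succ (f : ℤ → ℝ) (k : ℕ) (m : ℤ) :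
    (fwdDiff (1 : ℤ))^[k + 1] f m = (fwdDiff (1 : ℤ))^[k] f (m + 1) - (fwdDiff (1 : ℤ))^[k] f m := by
  rw [Function.iterate_succ_apply']
  rfl

theorem fwdDiff_relativeCount (n : ℕ) (m : ℤ) :
    (n + m + 1) * (fwdDiff (1 : ℤ))^[1] (relativeCount n) m =
      -(2 * m + 1) * (fwdDiff (1 : ℤ))^[0] (relativeCount n) m := by
  rw [fwdDiff_iterate_succ]
  simp only [Function.iterate_zero, id]
  linear_combination relativeCount_add_one n m

theorem fwdDiff_add_two_relativeCount (n k : ℕ) (m : ℤ) :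
    (n + m + k + 2) * (fwdDiff (1 : ℤ))^[k + 2] (relativeCount n) m =
      -(2 * m + 4 + 3 * k) * (fwdDiff (1 : ℤ))^[k + 1] (relativeCount n) m -
        2 * (k + 1) * (fwdDiff (1 : ℤ))^[k] (relativeCount n) m := by
  induction k generalizing m with
  | zero =>
    have h1 := fwdDiff_relativeCount n m
    have h2 := fwdDiff_relativeCount n (m + 1)
    have e0 := fwdDiff_iterate_succ (relativeCount n) 0 m
    have e1 := fwdDiff_iterate_succ (relativeCount n) 1 m
    simp only [Nat.zero_add, Nat.cast_zero, Nat.reduceAdd] at *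
    push_cast at *
    linear_combination h2 - h1 + (n + m + 2) * e1 + (2 * m + 3) * e0
  | succ k ih =>
    have h1 := ih m
    have h2 := ih (m + 1)
    have e0 := fwdDiff_iterate_succ (relativeCount n) k m
    have e1 := fwdDiff_iterate_succ (relativeCount n) (k + 1) m
    have e2 := fwdDiff_iterate_succ (relativeCount n) (k + 2) m
    rw [show k + 1 + 2 = k + 2 + 1 by ring]
    rw [show k + 1 + 1 = k + 2 by ring] at *
    push_cast at *
    linear_combination h2 - h1 + (n + m + k + 3) * e2 + (2 * m + 6 + 3 * k) * e1 + 2 * (k + 1) * e0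

theorem approx_fwdDiff_relativeCount {m : ℕ → ℤ} {x : ℝ}
    (hm : Approx (fun n => m n / √(n : ℝ)) x) (k : ℕ) :
    Approx (fun n => √(n : ℝ) ^ k * (fwdDiff (1 : ℤ))^[k] (relativeCount n) (m n))
      ((-1) ^ k * hermiteH k x * Real.exp (-x ^ 2)) := by
  have hu : ∀ b : ℝ, Approx (fun n : ℕ => 1 + m n / √(n : ℝ) * (√(n : ℝ))⁻¹ +
      b * ((√(n : ℝ))⁻¹ * (√(n : ℝ))⁻¹)) 1 := by
    intro b
    simpa using ((Approx.const 1).add (hm.mul Approx.inv_sqrt)).add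
      ((Approx.inv_sqrt.mul Approx.inv_sqrt).const_mul b)
  have hv : ∀ b : ℝ, Approx (fun n : ℕ => -(2 * (m n / √(n : ℝ)) + b * (√(n : ℝ))⁻¹)) (-(2 * x)) := by
    intro b
    simpa using ((hm.const_mul 2).add (Approx.inv_sqrt.const_mul b)).neg
  have hpos : ∀ᶠ n : ℕ in atTop, 0 < √(n : ℝ) :=
    (eventually_gt_atTop 0).mono fun n hn => by positivity
  have hu0 : ∀ b : ℝ, ∀ᶠ n : ℕ in atTop, 1 + m n / √(n : ℝ) * (√(n : ℝ))⁻¹ +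
      b * ((√(n : ℝ))⁻¹ * (√(n : ℝ))⁻¹) ≠ 0 :=
    fun b => (hu b).tendsto.eventually_ne one_ne_zero
  have hn_eq : ∀ b : ℝ, ∀ n : ℕ, 0 < √(n : ℝ) → (n : ℝ) + m n + b =
      √(n : ℝ) ^ 2 * (1 + m n / √(n : ℝ) * (√(n : ℝ))⁻¹ + b * ((√(n : ℝ))⁻¹ * (√(n : ℝ))⁻¹)) := by
    intro b n hn
    have hr : √(n : ℝ) ^ 2 = n := Real.sq_sqrt (Nat.cast_nonneg n)
    field_simp
    rw [hr]
  have h0 : Approx (fun n => √(n : ℝ) ^ 0 * (fwdDiff (1 : ℤ))^[0] (relativeCount n) (m n))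
      ((-1) ^ 0 * hermiteH 0 x * Real.exp (-x ^ 2)) := by
    simpa [hermiteH_zero] using approx_relativeCount hm
  induction k using Nat.twoStepInduction with
  | zero => exact h0
  | one =>
    have h := ((hv 1).mul h0).div (hu 1) one_ne_zero
    have e : (-1) ^ 1 * hermiteH 1 x * Real.exp (-x ^ 2) =
        -(2 * x) * ((-1) ^ 0 * hermiteH 0 x * Real.exp (-x ^ 2)) / 1 := by
      rw [hermiteH_one, hermiteH_zero]
      ring
    rw [e]
    refine h.congr' ?_
    filter_upwards [hpos, hu0 1] with n hn hne
    have hd := fwdDiff_relativeCount n (m n)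
    rw [hn_eq 1 n hn] at hd
    rw [div_eq_iff hne]
    have hn' := hn.ne'
    have e2 : (2 * m n + 1 : ℝ) = √(n : ℝ) * (2 * (m n / √(n : ℝ)) + 1 * (√(n : ℝ))⁻¹) := by
      field_simp
    rw [e2] at hd
    refine mul_left_cancel₀ hn' ?_
    linear_combination -hd
  | more k ih0 ih1 =>
    have h := (((hv (4 + 3 * k)).mul ih1).sub (ih0.const_mul (2 * (k + 1)))).div (hu (k + 2)) one_ne_zero
    have e : (-1) ^ (k + 2) * hermiteH (k + 2) x * Real.exp (-x ^ 2) =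
        (-(2 * x) * ((-1) ^ (k + 1) * hermiteH (k + 1) x * Real.exp (-x ^ 2)) -
          2 * (k + 1) * ((-1) ^ k * hermiteH k x * Real.exp (-x ^ 2))) / 1 := by
      rw [hermiteH_add_two]
      ring
    rw [e]
    refine h.congr' ?_
    filter_upwards [hpos, hu0 (k + 2)] with n hn hne
    have hd := fwdDiff_add_two_relativeCount n k (m n)
    rw [add_assoc, hn_eq (k + 2) n hn] at hd
    rw [div_eq_iff hne]
    have hn' := hn.ne'
    have e2 : (2 * m n + 4 + 3 * k : ℝ) =
        √(n : ℝ) * (2 * (m n / √(n : ℝ)) + (4 + 3 * k) * (√(n : ℝ))⁻¹) := by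
      field_simp
      ring
    rw [e2] at hd
    linear_combination -√(n : ℝ) ^ k * hd

/-- The coefficients of the `i`-th forward difference. -/
def diffCoeff (i k : ℕ) : ℝ := (-1) ^ (i - k) * i.choose k

theorem sum_diffCoeff (f : ℤ → ℝ) (s a : ℤ) {i N : ℕ} (hi : i < N) :
    ∑ k : Fin N, diffCoeff i k * f (a + k * s) = (fwdDiff s)^[i] f a := by
  rw [fwdDiff_iter_eq_sum_shift, ← Finset.sum_range (fun k : ℕ => diffCoeff i k * f (a + k * s))]
  rw [← Finset.sum_subset (Finset.range_subset_range.2 hi)]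
  · refine Finset.sum_congr rfl fun k _ => ?_
    simp [diffCoeff]
  · intro k _ hk
    rw [Finset.mem_range] at hk
    rw [diffCoeff, Nat.choose_eq_zero_of_lt (by omega), Nat.cast_zero, mul_zero, zero_mul]

theorem fwdDiff_neg_one_iterate (f : ℤ → ℝ) (i : ℕ) (a : ℤ) :
    (fwdDiff (-1 : ℤ))^[i] f a = (-1) ^ i * (fwdDiff (1 : ℤ))^[i] f (a - i) := by
  induction i generalizing a with
  | zero => simp
  | succ i ih =>
    rw [Function.iterate_succ_apply', fwdDiff, ih, ih, fwdDiff_iterate_succ]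
    push_cast
    rw [show a - (i + 1 : ℤ) + 1 = a - i by ring, show a + -1 - (i : ℤ) = a - (i + 1) by ring]
    ring

theorem det_diffCoeff (p : ℕ) : Matrix.det (Matrix.of fun i k : Fin p => diffCoeff i k) = 1 := by
  rw [Matrix.det_of_isLowerTriangular]
  · simp [diffCoeff]
  · intro i j hij
    have hij' : (i : ℕ) < j := hij
    simp [diffCoeff, Nat.choose_eq_zero_of_lt hij']

/-- The determinant that counts watermelons, in terms of differences of binomial coefficients. -/
theorem det_eq_det_fwdDiff (p : ℕ) (g : ℤ → ℝ) (h : ℤ) (b : ℝ) :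
    Matrix.det (Matrix.of fun i j : Fin p => g ((i : ℤ) - j) - b * g (h - i - j)) =
      Matrix.det (Matrix.of fun i j : Fin p =>
        (-1) ^ (j : ℕ) * (fwdDiff (1 : ℤ))^[(i : ℕ) + j] g (-j) -
          b * ((-1) ^ ((i : ℕ) + j) * (fwdDiff (1 : ℤ))^[(i : ℕ) + j] g (h - i - j))) := by
  have hmul : Matrix.det ((Matrix.of fun i k : Fin p => diffCoeff i k) *
      (Matrix.of fun i j : Fin p => g ((i : ℤ) - j) - b * g (h - i - j)) *
      (Matrix.of fun i k : Fin p => diffCoeff i k).transpose) =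
      Matrix.det (Matrix.of fun i j : Fin p => g ((i : ℤ) - j) - b * g (h - i - j)) := by
    rw [Matrix.det_mul, Matrix.det_mul, Matrix.det_transpose, det_diffCoeff, one_mul, mul_one]
  rw [← hmul]
  congr 1
  ext i j
  have h1 : ∀ l : Fin p, ∑ k : Fin p, diffCoeff i k * (g ((k : ℤ) - l) - b * g (h - k - l)) =
      (fwdDiff (1 : ℤ))^[i] g (0 + (l : ℕ) * (-1)) -
        b * ((-1) ^ (i : ℕ) * (fwdDiff (1 : ℤ))^[i] g (h - i + (l : ℕ) * (-1))) := by
    intro l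
    have e1 := sum_diffCoeff g 1 (0 + (l : ℕ) * (-1)) i.2
    have e2 := sum_diffCoeff g (-1) (h - l) i.2
    rw [fwdDiff_neg_one_iterate] at e2
    rw [show h - (i : ℕ) + (l : ℕ) * (-1) = h - (l : ℕ) - (i : ℕ) by ring, ← e1, ← e2,
      Finset.mul_sum, ← Finset.sum_sub_distrib]
    refine Finset.sum_congr rfl fun k _ => ?_
    rw [show 0 + ((l : ℕ) : ℤ) * (-1) + (k : ℕ) * 1 = (k : ℕ) - (l : ℕ) by ring,
      show h - ((l : ℕ) : ℤ) + (k : ℕ) * (-1) = h - (k : ℕ) - (l : ℕ) by ring]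
    ring
  rw [Matrix.mul_apply]
  simp only [Matrix.mul_apply, Matrix.transpose_apply, Matrix.of_apply, h1]
  have e1 := sum_diffCoeff ((fwdDiff (1 : ℤ))^[i] g) (-1) 0 j.2
  have e2 := sum_diffCoeff ((fwdDiff (1 : ℤ))^[i] g) (-1) (h - i) j.2
  rw [fwdDiff_neg_one_iterate, ← Function.iterate_add_apply, add_comm (j : ℕ)] at e1 e2
  rw [zero_sub] at e1
  rw [pow_add, mul_assoc ((-1 : ℝ) ^ (i : ℕ)), ← e1, ← e2, Finset.mul_sum, Finset.mul_sum,
    ← Finset.sum_sub_distrib]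
  exact Finset.sum_congr rfl fun k _ => by ring

/-- The normalised counting determinant; `b = 1` takes the line of ordinate `h` into account,
`b = 0` does not. -/
noncomputable def scaledDet (p : ℕ) (b : ℝ) (h : ℤ) (n : ℕ) : ℝ :=
  Matrix.det (Matrix.of fun i j : Fin p =>
    (-1) ^ (j : ℕ) * (√(n : ℝ) ^ ((i : ℕ) + j) *
      (fwdDiff (1 : ℤ))^[(i : ℕ) + j] (relativeCount n) (-j)) -
    b * ((-1) ^ ((i : ℕ) + j) * (√(n : ℝ) ^ ((i : ℕ) + j) *
      (fwdDiff (1 : ℤ))^[(i : ℕ) + j] (relativeCount n) (h - i - j))))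

theorem scaledDet_eq (p : ℕ) (b : ℝ) (h : ℤ) (n : ℕ) :
    scaledDet p b h n = (∏ i : Fin p, √(n : ℝ) ^ (i : ℕ)) ^ 2 / walkCount (2 * n) 0 ^ p *
      Matrix.det (Matrix.of fun i j : Fin p =>
        walkCount (2 * n) (2 * ((j : ℤ) - i)) - b * walkCount (2 * n) (2 * (h - i - j))) := by
  have hc := (walkCount_pos n).ne'
  have h1 : (Matrix.of fun i j : Fin p =>
      walkCount (2 * n) (2 * ((j : ℤ) - i)) - b * walkCount (2 * n) (2 * (h - i - j))) =
      walkCount (2 * n) 0 • (Matrix.of fun i j : Fin p =>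
        relativeCount n ((i : ℤ) - j) - b * relativeCount n (h - i - j)) := by
    ext i j
    rw [Matrix.smul_apply, Matrix.of_apply, Matrix.of_apply, ← relativeCount_neg, neg_sub,
      relativeCount, relativeCount, smul_eq_mul]
    field_simp
  rw [h1, Matrix.det_smul, Fintype.card_fin, ← mul_assoc, div_mul_cancel₀ _ (pow_ne_zero _ hc),
    det_eq_det_fwdDiff, sq, mul_assoc, ← Matrix.det_mul_row, ← Matrix.det_mul_column, scaledDet]
  congr 1
  ext i j
  simp only [Matrix.of_apply]
  ring

theorem approx_scaledDet (p : ℕ) (b : ℝ) {h : ℕ → ℤ} {t : ℝ}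
    (hh : Approx (fun n => h n / √(n : ℝ)) t) :
    Approx (fun n => scaledDet p b (h n) n) (Matrix.det (Matrix.of fun i j : Fin p =>
      (-1) ^ (i : ℕ) * hermiteH (i + j) 0 -
        b * (hermiteH (i + j) t * Real.exp (-t ^ 2)))) := by
  refine Approx.det fun i j => ?_
  have h1 : Approx (fun n => ((-(j : ℕ) : ℤ) : ℝ) / √(n : ℝ)) 0 := by
    simpa [div_eq_mul_inv] using (Approx.inv_sqrt.const_mul (-((j : ℕ) : ℝ)))
  have h2 : Approx (fun n => ((h n - (i : ℕ) - (j : ℕ) : ℤ) : ℝ) / √(n : ℝ)) t := by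
    have := hh.sub (Approx.inv_sqrt.const_mul (((i : ℕ) : ℝ) + (j : ℕ)))
    rw [mul_zero, sub_zero] at this
    refine this.congr' (Eventually.of_forall fun n => ?_)
    push_cast
    ring
  have hA := (approx_fwdDiff_relativeCount h1 ((i : ℕ) + j)).const_mul ((-1) ^ (j : ℕ))
  have hB := (approx_fwdDiff_relativeCount h2 ((i : ℕ) + j)).const_mul ((-1) ^ ((i : ℕ) + j))
  have hsq : ∀ k : ℕ, (-1 : ℝ) ^ k * (-1) ^ k = 1 := fun k => by
    rw [← mul_pow]
    norm_num
  have key := hA.sub (hB.const_mul b)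
  convert key using 1
  simp only [Matrix.of_apply]
  have e0 : Real.exp (-(0 : ℝ) ^ 2) = 1 := by simp
  rw [e0, Matrix.of_apply]
  linear_combination -((-1) ^ (i : ℕ) * hermiteH (i + j) 0) * hsq j +
    b * hermiteH (i + j) t * Real.exp (-t ^ 2) * hsq (i + j)

theorem approx_floor_div {t : ℝ} : Approx (fun n : ℕ => (⌊t * √(n : ℝ)⌋ : ℝ) / √(n : ℝ)) t := by
  refine IsBigO.of_bound 1 ?_
  filter_upwards [eventually_gt_atTop 0] with n hn
  have hpos : 0 < √(n : ℝ) := by positivity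
  have h1 := Int.floor_le (t * √(n : ℝ))
  have h2 := Int.lt_floor_add_one (t * √(n : ℝ))
  have e : (⌊t * √(n : ℝ)⌋ : ℝ) / √(n : ℝ) - t = (⌊t * √(n : ℝ)⌋ - t * √(n : ℝ)) * (√(n : ℝ))⁻¹ := by
    field_simp
  rw [e, norm_mul, Real.norm_eq_abs]
  gcongr
  rw [abs_le]
  constructor <;> linarith

theorem mainTheorem1 (p : ℕ) (hp : 0 < p) (t : ℝ) (ht : 0 < t) :
    (fun n : ℕ =>
      (Watermelon.uniform p n).real
          {w | ((Watermelon.height hp w : ℝ) + 1) / Real.sqrt (n : ℝ) ≤ t} -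
        heightLimit p t)
      =O[atTop] (fun n : ℕ => (n : ℝ) ^ (-(1 / 2) : ℝ) * Real.exp (-t ^ 2)) := by
  have hfloor := approx_floor_div (t := t)
  have hD := approx_scaledDet p 1 hfloor
  have hD0 := approx_scaledDet p 0 hfloor
  simp only [one_mul, zero_mul, sub_zero] at hD hD0
  rw [det_hermiteH_zero] at hD0
  have hfac : (0 : ℝ) < 2 ^ p.choose 2 * ∏ j ∈ Finset.range p, (j ! : ℝ) := by positivity
  have hlim : heightLimit p t = Matrix.det (Matrix.of fun i j : Fin p =>
      (-1) ^ (i : ℕ) * hermiteH (i + j) 0 - hermiteH (i + j) t * Real.exp (-t ^ 2)) /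
      (2 ^ p.choose 2 * ∏ j ∈ Finset.range p, (j ! : ℝ)) := by
    rw [heightLimit, div_eq_mul_inv, div_eq_mul_inv, mul_inv]
    ring
  have key : Approx (fun n => (Watermelon.uniform p n).real
      {w | ((Watermelon.height hp w : ℝ) + 1) / Real.sqrt (n : ℝ) ≤ t}) (heightLimit p t) := by
    rw [hlim]
    refine (hD.div hD0 hfac.ne').congr' ?_
    have hlarge : ∀ᶠ n : ℕ in atTop, (2 * p : ℝ) ≤ t * √(n : ℝ) :=
      ((Real.tendsto_sqrt_atTop.comp tendsto_natCast_atTop_atTop).const_mul_atTop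
        ht).eventually_ge_atTop _
    filter_upwards [eventually_gt_atTop 0, hlarge] with n hn hl
    have hpos : 0 < √(n : ℝ) := by positivity
    have hset : {w : Watermelon p n | ((Watermelon.height hp w : ℝ) + 1) / Real.sqrt (n : ℝ) ≤ t} =
        {w | Watermelon.height hp w < ⌊t * √(n : ℝ)⌋} := by
      ext w
      rw [Set.mem_ofPred_eq, Set.mem_ofPred_eq, div_le_iff₀ hpos, Int.lt_iff_add_one_le, Int.le_floor]
      push_cast
      rfl
    have hh : 2 * (p : ℤ) ≤ ⌊t * √(n : ℝ)⌋ := by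
      rw [Int.le_floor]
      exact_mod_cast hl
    rw [hset, Watermelon.uniform_real_eq, Watermelon.ncard_height_lt hp n hh,
      Watermelon.card_eq_det hp, scaledDet_eq, scaledDet_eq, mul_div_mul_left]
    · simp only [one_mul, zero_mul, sub_zero]
    · have := walkCount_pos n
      have : 0 < ∏ i : Fin p, √(n : ℝ) ^ (i : ℕ) := Finset.prod_pos fun i _ => by positivity
      positivity
  have hrhs : (fun n : ℕ => (√(n : ℝ))⁻¹) =O[atTop]
      (fun n : ℕ => (n : ℝ) ^ (-(1 / 2) : ℝ) * Real.exp (-t ^ 2)) := by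
    refine IsBigO.of_bound (Real.exp (t ^ 2)) (Eventually.of_forall fun n => le_of_eq ?_)
    rw [Real.rpow_neg (Nat.cast_nonneg n), ← Real.sqrt_eq_rpow, norm_mul,
      Real.norm_of_nonneg (Real.exp_pos _).le, mul_left_comm, ← Real.exp_add]
    simp
  exact IsBigO.trans key hrhs
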